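/- Let $G=(V,E)$ be a finite connected undirected simple graph, let $c\colon E\to\mathbb{R}$ be edge costs and $\mu\ge 0$, and give each edge the weight $w(e)=\exp(-\mu c(e))$, with $w(\{u,v\})=0$ if $\{u,v\}\notin E$. Let $s_1\neq s_2$ be two nodes (the seeds). Probabilistic Watershed. For $u,v\in V$ let $\mathcal{F}_{u}^{v}$ be the set of spanning forests of $G$ that consist of exactly two trees and have $u$ and $v$ in different trees, and let $\mathcal{F}_{u,q}^{v}=\mathcal{F}_{u}^{v}\cap\mathcal{F}_{q}^{v}$. For $f\in\mathcal{F}_{s_1}^{s_2}$ let $c(f)$ be the sum of the costs of the edges of $f$, and define the Gibbs distribution $P(f)=\exp(-\mu c(f))\big/\sum_{f'\in\mathcal{F}_{s_1}^{s_2}}\exp(-\mu c(f'))$. For $q\in V$ put $$P(q\sim s_1)=\sum_{f\in\mathcal{F}_{s_1,q}^{s_2}}P(f).$$ Random Walker. Consider the random walk on $V$ that moves from $v$ to $u$ with probability $w(\{v,u\})/\sum_{k\in V}w(\{v,k\})$, and let $x_q^{s_1}$ be the probability that this walk, started at $q$, reaches $s_1$ before reaching $s_2$. Let $L$ be the weighted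 Laplacian of $G$, that is, $L_{uv}=-w(\{u,v\})$ for $u\ne v$ and $L_{uu}=\sum_{k\in V}w(\{u,k\})$. Let $U=V\setminus\{s_1,s_2\}$, let $L_U$ be the submatrix of $L$ with rows and columns in $U$, and let $B=(L_{us_1})_{u\in U}$. Then for every $q\in V$ $$x_q^{s_1}=P(q\sim s_1).$$ Moreover, the vector $y=(P(q\sim s_1))_{q\in V}$ is the unique $y\in\mathbb{R}^V$ that satisfies $y_{s_1}=1$, $y_{s_2}=0$ and the Random Walker's linear system $L_U\,y_U=-B$. -/

import Mathlib

namespace ProbWatershed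

open MeasureTheory ProbabilityTheory
open scoped ENNReal Matrix

noncomputable section

variable {V : Type*}

/-! ### Weights and the Laplacian -/

/-- The edge weight `w(e) = exp(-μ c(e))` of an edge of cost `c e`. -/
def edgeWeight (c : Sym2 V → ℝ) (μ : ℝ) (e : Sym2 V) : ℝ :=
  Real.exp (-μ * c e)

open Classical in
/-- The weight `w({u,v})`, extended by `0` to the pairs that are not edges of `G`. -/
def pairWeight (G : SimpleGraph V) (w : Sym2 V → ℝ) (u v : V) : ℝ :=
  if G.Adj u v then w s(u, v) else 0

open Classical in
/-- The weighted Laplacian of `G`. -/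
def laplacian [Fintype V] (G : SimpleGraph V) (w : Sym2 V → ℝ) : Matrix V V ℝ :=
  Matrix.of fun u v =>
    if u = v then ∑ k, pairWeight G w u k else -pairWeight G w u v

/-! ### The Probabilistic Watershed -/

/-- The spanning forests of `G` with exactly two trees, such that `u` and `v` lie in different
trees. A spanning subgraph of `G` is a graph on the same vertex type below `G`. -/
def twoForests (G : SimpleGraph V) (u v : V) : Set (SimpleGraph V) :=
  {f | f ≤ G ∧ f.IsAcyclic ∧ Nat.card f.ConnectedComponent = 2 ∧ ¬ f.Reachable u v}

/-- The 2-forests with `u` and `q` in one tree and `v` in the other one. -/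
def twoForestsThree (G : SimpleGraph V) (u q v : V) : Set (SimpleGraph V) :=
  twoForests G u v ∩ twoForests G q v

open Classical in
/-- The cost of a graph: the sum of the costs of its edges. -/
def graphCost [Fintype V] (c : Sym2 V → ℝ) (f : SimpleGraph V) : ℝ :=
  ∑ e ∈ f.edgeFinset, c e

open Classical in
/-- The Gibbs probability of the 2-forest `f` among the 2-forests that separate `s₁` and `s₂`. -/
def gibbs [Fintype V] (G : SimpleGraph V) (c : Sym2 V → ℝ) (μ : ℝ) (s₁ s₂ : V)
    (f : SimpleGraph V) : ℝ :=
  Real.exp (-μ * graphCost c f) /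
    ∑ f' ∈ (twoForests G s₁ s₂).toFinset, Real.exp (-μ * graphCost c f')

open Classical in
/-- The Probabilistic Watershed probability `P(q ∼ s₁)`: the Gibbs probability of sampling a
2-forest that separates the seeds and connects `q` with `s₁`. -/
def watershedProb [Fintype V] (G : SimpleGraph V) (c : Sym2 V → ℝ) (μ : ℝ) (s₁ s₂ q : V) : ℝ :=
  ∑ f ∈ (twoForestsThree G s₁ q s₂).toFinset, gibbs G c μ s₁ s₂ f

/-! ### The random walk on the weighted graph -/

/-- One step of the random walk from `v`: move to `u` with probability proportional to the weight
`w({v,u})`. A vertex without an edge of positive weight (there is none in a connected graph with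
two vertices and positive weights) is absorbing. -/
def stepPMF [Fintype V] (G : SimpleGraph V) (w : Sym2 V → ℝ) (v : V) : PMF V :=
  open Classical in
  if h : ∑' u, ENNReal.ofReal (pairWeight G w v u) = 0 then PMF.pure v
  else PMF.normalize (fun u => ENNReal.ofReal (pairWeight G w v u)) h
    (by rw [tsum_fintype]; exact ENNReal.sum_ne_top.2 fun _ _ => ENNReal.ofReal_ne_top)

/-- The transition kernel from the path up to time `n` to the position at time `n + 1`; it depends
on the path through its last position only. -/
def stepKernel [Fintype V] [MeasurableSpace V] [MeasurableSingletonClass V]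
    (G : SimpleGraph V) (w : Sym2 V → ℝ) (n : ℕ) : Kernel (Finset.Iic n → V) V where
  toFun p := (stepPMF G w (p ⟨n, Finset.mem_Iic.2 le_rfl⟩)).toMeasure
  measurable' := measurable_of_countable _

instance [Fintype V] [MeasurableSpace V] [MeasurableSingletonClass V]
    (G : SimpleGraph V) (w : Sym2 V → ℝ) (n : ℕ) : IsMarkovKernel (stepKernel G w n) :=
  ⟨fun _ => PMF.toMeasure.isProbabilityMeasure _⟩

/-- The law, on the space `ℕ → V` of trajectories, of the random walk started at `q`. -/
def walkLaw [Fintype V] [MeasurableSpace V] [MeasurableSingletonClass V]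
    (G : SimpleGraph V) (w : Sym2 V → ℝ) (q : V) : Measure (ℕ → V) :=
  Kernel.traj (X := fun _ => V) (stepKernel G w) 0 (fun _ => q)

/-- The probability that the random walk started at `q` reaches `s₁` before reaching `s₂`. -/
def hitProb [Fintype V] [MeasurableSpace V] [MeasurableSingletonClass V]
    (G : SimpleGraph V) (w : Sym2 V → ℝ) (s₁ s₂ q : V) : ℝ :=
  (walkLaw G w q).real {ω | ∃ n, ω n = s₁ ∧ ∀ m ≤ n, ω m ≠ s₂}

/-! ### The linear system of the Random Walker -/

/-- The unseeded vertices. -/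
abbrev Unseeded (s₁ s₂ : V) : Type _ := {v : V // v ≠ s₁ ∧ v ≠ s₂}

open Classical in
/-- `x` solves the Random Walker's Dirichlet problem with the boundary values `1` at `s₁` and `0`
at `s₂`: `L_U x_U = -B`, where `L_U` is the block of the Laplacian on the unseeded vertices and
`B` is the column of `s₁` in the unseeded rows. -/
def IsRandomWalkerSolution [Fintype V] (G : SimpleGraph V) (w : Sym2 V → ℝ) (s₁ s₂ : V)
    (x : V → ℝ) : Prop :=
  x s₁ = 1 ∧ x s₂ = 0 ∧
    (laplacian G w).submatrix (Subtype.val : Unseeded s₁ s₂ → V) Subtype.val *ᵥ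
        (fun u : Unseeded s₁ s₂ => x u) =
      -(fun u : Unseeded s₁ s₂ => laplacian G w u s₁)

end

end ProbWatershed

namespace ProbWatershed

open MeasureTheory ProbabilityTheory
open scoped ENNReal Matrix

noncomputable section

variable {V : Type*}

/-! ### Trees and two-forests -/

/-! Both quantities solve the same Dirichlet problem (`IsDirichletSolution`), and the maximum
principle allows only one solution. By `laplacian_mulVec` the linear system is this problem in
matrix form.

For the watershed, fix an unseeded `q`. A 2-forest `f` separating the seeds contributes to `P(q ∼
s₁) - P(k ∼ s₁)` only if it separates `q` from `k`: positively if `q` is with `s₁`, negatively if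
`q` is with `s₂`. If `qk` is an edge, adding it to such an `f` gives a spanning tree `T`, and the
weight of `f` times `w(qk)` is the weight of `T`. After summing over `k`, each `T` is counted
positively once if its paths from `q` to `s₁` and `s₂` leave by different edges, and negatively
under the same symmetric condition. Hence everything cancels (`sum_twoForests_eq_sum_trees`,
`card_isNextTo_comm`).

For the walk, stop it at the seeds. The probability of having hit `s₁` first by time `n` is the
`n`-th iterate of the one-step average on the indicator of `s₁`. Its limit `hitProb` is fixed by
that average, hence harmonic; almost sure absorption is not needed. -/

theorem mem_twoForests_iff {G : SimpleGraph V} {u v : V} {f : SimpleGraph V} :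
    f ∈ twoForests G u v ↔ f ≤ G ∧ f.IsAcyclic ∧ ¬ f.Reachable u v ∧
      ∀ x, f.Reachable u x ∨ f.Reachable v x := by
  refine and_congr_right fun _ => and_congr_right fun _ => ?_
  rw [Nat.card_eq_two_iff' (f.connectedComponentMk u)]
  constructor
  · rintro ⟨⟨y, hy, huniq⟩, huv⟩
    refine ⟨huv, fun x => ?_⟩
    by_contra! hx
    have h₁ := huniq (f.connectedComponentMk x) fun h =>
      hx.1 (SimpleGraph.ConnectedComponent.eq.1 h).symm
    have h₂ := huniq (f.connectedComponentMk v) fun h =>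
      huv (SimpleGraph.ConnectedComponent.eq.1 h).symm
    exact hx.2 (SimpleGraph.ConnectedComponent.eq.1 (h₂.trans h₁.symm))
  · rintro ⟨huv, hx⟩
    refine ⟨⟨f.connectedComponentMk v, fun h =>
      huv (SimpleGraph.ConnectedComponent.eq.1 h).symm, fun y => ?_⟩, huv⟩
    induction y using SimpleGraph.ConnectedComponent.ind with
    | h x =>
      intro hne
      rcases hx x with h | h
      · exact absurd (SimpleGraph.ConnectedComponent.eq.2 h.symm) hne
      · exact SimpleGraph.ConnectedComponent.eq.2 h.symm

theorem twoForests_comm (G : SimpleGraph V) (u v : V) : twoForests G u v = twoForests G v u := by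
  ext f
  simp only [mem_twoForests_iff, SimpleGraph.reachable_comm (u := u) (v := v),
    or_comm (a := f.Reachable u _)]

theorem not_reachable_left_iff {G : SimpleGraph V} {u v : V} {f : SimpleGraph V}
    (hf : f ∈ twoForests G u v) (x : V) : ¬ f.Reachable u x ↔ f.Reachable v x := by
  obtain ⟨-, -, huv, hx⟩ := mem_twoForests_iff.1 hf
  exact ⟨(hx x).resolve_left, fun h h' => huv (h'.trans h.symm)⟩

/-- After deleting an edge `ab` of a connected graph, every vertex is still connected to `a`
or `b`. -/
theorem reachable_deleteEdges_or {T : SimpleGraph V} {a b : V} (x : V) (h : T.Reachable x a) :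
    (T.deleteEdges {s(a, b)}).Reachable a x ∨ (T.deleteEdges {s(a, b)}).Reachable b x := by
  obtain ⟨p⟩ := h
  induction p with
  | nil => exact .inl .rfl
  | @cons u v w huv p ih =>
    by_cases he : s(u, v) = s(w, b)
    · rcases Sym2.eq_iff.1 he with ⟨rfl, -⟩ | ⟨rfl, -⟩
      · exact .inl .rfl
      · exact .inr .rfl
    · have : (T.deleteEdges {s(w, b)}).Adj v u := by
        rw [SimpleGraph.deleteEdges_adj]
        exact ⟨huv.symm, by rwa [Sym2.eq_swap (a := v)]⟩
      exact ih.imp (·.trans this.reachable) (·.trans this.reachable)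

theorem not_reachable_deleteEdges {T : SimpleGraph V} (hT : T.IsAcyclic) {a b : V}
    (h : T.Adj a b) : ¬ (T.deleteEdges {s(a, b)}).Reachable a b :=
  SimpleGraph.isBridge_iff.1 (SimpleGraph.isAcyclic_iff_forall_adj_isBridge.1 hT h)

/-- Deleting an edge of a spanning tree gives a two-forest. -/
theorem deleteEdges_mem_twoForests {G T : SimpleGraph V} (hTG : T ≤ G) (hT : T.IsTree)
    {a b s t : V} (hab : T.Adj a b) (hs : (T.deleteEdges {s(a, b)}).Reachable s a)
    (ht : (T.deleteEdges {s(a, b)}).Reachable t b) :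
    T.deleteEdges {s(a, b)} ∈ twoForests G s t := by
  refine mem_twoForests_iff.2 ⟨(SimpleGraph.deleteEdges_le _).trans hTG,
    hT.isAcyclic.anti (SimpleGraph.deleteEdges_le _), fun h =>
      not_reachable_deleteEdges hT.isAcyclic hab (hs.symm.trans (h.trans ht)), fun x => ?_⟩
  exact (reachable_deleteEdges_or x (hT.connected.preconnected x a)).imp hs.trans ht.trans

/-- Joining the two trees of a two-forest by an edge gives a tree. -/
theorem isTree_sup_edge {G f : SimpleGraph V} {a b s t : V} (hf : f ∈ twoForests G s t)
    (hs : f.Reachable s a) (ht : f.Reachable t b) : (f ⊔ SimpleGraph.edge a b).IsTree := by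
  obtain ⟨-, hac, hst, hx⟩ := mem_twoForests_iff.1 hf
  have hab : ¬ f.Reachable a b := fun h => hst (hs.trans (h.trans ht.symm))
  refine ⟨?_, hac.sup_edge_of_not_reachable hab⟩
  have hne : a ≠ b := by rintro rfl; exact hab .rfl
  have hadj : (f ⊔ SimpleGraph.edge a b).Adj a b := by simp [SimpleGraph.edge_adj, hne]
  have hr : ∀ x, (f ⊔ SimpleGraph.edge a b).Reachable a x := fun x => by
    rcases hx x with h | h
    · exact (hs.symm.trans h).mono le_sup_left
    · exact hadj.reachable.trans ((ht.symm.trans h).mono le_sup_left)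
  have : Nonempty V := ⟨a⟩
  exact ⟨fun x y => (hr x).symm.trans (hr y)⟩

theorem sup_edge_deleteEdges {f : SimpleGraph V} {a b : V} (hab : ¬ f.Adj a b) :
    (f ⊔ SimpleGraph.edge a b).deleteEdges {s(a, b)} = f := by
  ext x y
  simp only [SimpleGraph.deleteEdges_adj, SimpleGraph.sup_adj, SimpleGraph.adj_edge,
    Set.mem_singleton_iff]
  constructor
  · rintro ⟨h | h, h'⟩
    · exact h
    · exact absurd h.1.symm h'
  · intro h
    refine ⟨.inl h, fun h' => hab ?_⟩
    rw [← SimpleGraph.mem_edgeSet, ← h']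
    exact h

theorem deleteEdges_sup_edge {T : SimpleGraph V} {a b : V} (hab : T.Adj a b) :
    T.deleteEdges {s(a, b)} ⊔ SimpleGraph.edge a b = T := by
  ext x y
  simp only [SimpleGraph.deleteEdges_adj, SimpleGraph.sup_adj, SimpleGraph.adj_edge,
    Set.mem_singleton_iff]
  constructor
  · rintro (h | h)
    · exact h.1
    · rw [← SimpleGraph.mem_edgeSet, ← h.1]
      exact hab
  · intro h
    by_cases h' : s(x, y) = s(a, b)
    · exact .inr ⟨h'.symm, h.ne⟩
    · exact .inl ⟨h, h'⟩

/-- `k` is the neighbour of `q` in `T` in the direction of `s`. -/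
def IsNextTo (T : SimpleGraph V) (q s k : V) : Prop :=
  T.Adj q k ∧ (T.deleteEdges {s(q, k)}).Reachable s k

/-- A walk that avoids `q` survives the deletion of an edge at `q`. -/
theorem reachable_deleteEdges_of_notMem_support {T : SimpleGraph V} {q k u v : V}
    (p : T.Walk u v) (hp : q ∉ p.support) : (T.deleteEdges {s(q, k)}).Reachable u v :=
  ⟨p.toDeleteEdges _ fun _ he hek => hp <|
    p.fst_mem_support_of_mem_edges (Set.mem_singleton_iff.1 hek ▸ he)⟩

/-- The first step of the path from `q` to `s` qualifies. A second such neighbour `k'` would be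
joined to `q` through `s` without the edge `qk'`, which is a bridge. -/
theorem existsUnique_isNextTo {T : SimpleGraph V} (hT : T.IsTree) {q s : V} (hqs : q ≠ s) :
    ∃! k, IsNextTo T q s k := by
  classical
  obtain ⟨p, hp⟩ := (hT.connected.preconnected q s).exists_isPath
  cases p with
  | nil => exact absurd rfl hqs
  | @cons _ k _ hqk p =>
    rw [SimpleGraph.Walk.cons_isPath_iff] at hp
    have hk : (T.deleteEdges {s(q, k)}).Reachable s k :=
      (reachable_deleteEdges_of_notMem_support p hp.2).symm
    refine ⟨k, ⟨hqk, hk⟩, fun k' ⟨hqk', hk'⟩ => ?_⟩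
    by_contra hne
    refine not_reachable_deleteEdges hT.isAcyclic hqk' ?_
    have hadj : (T.deleteEdges {s(q, k')}).Adj q k := by
      rw [SimpleGraph.deleteEdges_adj]
      refine ⟨hqk, fun h => hne ?_⟩
      exact (Sym2.congr_right.1 (Set.mem_singleton_iff.1 h)).symm
    exact (hadj.reachable.trans (reachable_deleteEdges_of_notMem_support p hp.2)).trans hk'

/-- Deleting a tree edge leaves exactly two sides, so `s` lies on the side of `q` precisely when it
does not lie on that of `k`. -/
theorem reachable_and_isNextTo_iff {T : SimpleGraph V} (hT : T.IsTree) {q s t : V} (k : V) :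
    (T.Adj q k ∧ (T.deleteEdges {s(q, k)}).Reachable s q ∧
      (T.deleteEdges {s(q, k)}).Reachable t k) ↔ IsNextTo T q t k ∧ ¬ IsNextTo T q s k := by
  constructor
  · rintro ⟨h, hs, ht⟩
    exact ⟨⟨h, ht⟩, fun h' => not_reachable_deleteEdges hT.isAcyclic h (hs.symm.trans h'.2)⟩
  · rintro ⟨⟨h, ht⟩, hs⟩
    refine ⟨h, ?_, ht⟩
    rcases reachable_deleteEdges_or (b := k) s (hT.connected.preconnected s q) with h' | h'
    · exact h'.symm
    · exact absurd ⟨h, h'.symm⟩ hs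

open Classical in
/-- In a tree, `q` has a neighbour towards `t` that does not lead to `s` iff it has one towards
`s` that does not lead to `t`, and each is unique. -/
theorem card_isNextTo_comm [Fintype V] {T : SimpleGraph V} (hT : T.IsTree) {q s t : V}
    (hqs : q ≠ s) (hqt : q ≠ t) :
    (Finset.univ.filter fun k => IsNextTo T q t k ∧ ¬ IsNextTo T q s k).card =
      (Finset.univ.filter fun k => IsNextTo T q s k ∧ ¬ IsNextTo T q t k).card := by
  obtain ⟨a, ha, ha'⟩ := existsUnique_isNextTo hT hqs
  obtain ⟨b, hb, hb'⟩ := existsUnique_isNextTo hT hqt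
  have hs : ∀ k, IsNextTo T q s k ↔ k = a := fun k => ⟨ha' k, fun h => h ▸ ha⟩
  have ht : ∀ k, IsNextTo T q t k ↔ k = b := fun k => ⟨hb' k, fun h => h ▸ hb⟩
  simp only [hs, ht]
  by_cases hab : a = b
  · simp [hab]
  · rw [Finset.card_eq_one.2 ⟨b, ?_⟩, Finset.card_eq_one.2 ⟨a, ?_⟩]
    · ext k; simp only [Finset.mem_filter, Finset.mem_univ, true_and, Finset.mem_singleton]
      exact ⟨fun h => h.1, fun h => ⟨h, h ▸ hab⟩⟩
    · ext k; simp only [Finset.mem_filter, Finset.mem_univ, true_and, Finset.mem_singleton]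
      exact ⟨fun h => h.1, fun h => ⟨h, h ▸ Ne.symm hab⟩⟩

/-- Keeps the Gibbs denominator nonzero: cut a spanning tree at the first edge from `s` towards `t`.
-/
theorem nonempty_twoForests {G : SimpleGraph V} (hG : G.Connected) {s t : V} (hst : s ≠ t) :
    (twoForests G s t).Nonempty := by
  obtain ⟨T, hTG, hmax⟩ := SimpleGraph.exists_maximal_isAcyclic_of_le_isAcyclic
    (G := G) bot_le SimpleGraph.isAcyclic_bot
  have hT : T.IsTree := (hG.maximal_le_isAcyclic_iff_isTree hmax.prop.1).1 hmax
  obtain ⟨k, hk, -⟩ := existsUnique_isNextTo hT hst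
  exact ⟨_, deleteEdges_mem_twoForests hmax.prop.1 hT hk.1 .rfl hk.2⟩

/-! ### The weighted count of two-forests -/

/-- The Gibbs weight of a graph. -/
def graphWeight [Fintype V] (c : Sym2 V → ℝ) (μ : ℝ) (f : SimpleGraph V) : ℝ :=
  Real.exp (-μ * graphCost c f)

theorem graphWeight_sup_edge [Fintype V] (c : Sym2 V → ℝ) (μ : ℝ) {f : SimpleGraph V} {a b : V}
    (hne : a ≠ b) (hab : ¬ f.Adj a b) :
    graphWeight c μ (f ⊔ SimpleGraph.edge a b) = edgeWeight c μ s(a, b) * graphWeight c μ f := by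
  classical
  have : graphCost c (f ⊔ SimpleGraph.edge a b) = c s(a, b) + graphCost c f := by
    unfold graphCost
    rw [← Finset.sum_cons (s := f.edgeFinset) (a := s(a, b)) (h := by simpa using hab)]
    refine Finset.sum_congr ?_ fun _ _ => rfl
    ext e
    rw [← SimpleGraph.edgeFinset_sup_edge f hab hne]
    simp only [SimpleGraph.mem_edgeFinset]
  rw [graphWeight, graphWeight, edgeWeight, ← Real.exp_add, this]
  ring_nf

open Classical in
/-- The two-forests whose trees can be joined by the edge `ab` correspond to the spanning trees
through that edge. -/
theorem sum_twoForests_eq_sum_trees [Fintype V] (G : SimpleGraph V) (c : Sym2 V → ℝ) (μ : ℝ)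
    {s t a b : V} :
    pairWeight G (edgeWeight c μ) a b * ∑ f : SimpleGraph V with
        f ∈ twoForests G s t ∧ f.Reachable s a ∧ f.Reachable t b, graphWeight c μ f =
      ∑ T : SimpleGraph V with (T ≤ G ∧ T.IsTree) ∧ T.Adj a b ∧
        (T.deleteEdges {s(a, b)}).Reachable s a ∧ (T.deleteEdges {s(a, b)}).Reachable t b,
        graphWeight c μ T := by
  unfold pairWeight
  split_ifs with hG
  · rw [Finset.mul_sum]
    have key : ∀ f : SimpleGraph V, f ∈ twoForests G s t → f.Reachable s a → f.Reachable t b →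
        ¬ f.Adj a b := fun f hf hs ht h =>
      (mem_twoForests_iff.1 hf).2.2.1 (hs.trans (h.reachable.trans ht.symm))
    refine Finset.sum_nbij' (fun f => f ⊔ SimpleGraph.edge a b)
      (fun T => T.deleteEdges {s(a, b)}) ?_ ?_ ?_ ?_ ?_
    · simp only [Finset.mem_filter, Finset.mem_univ, true_and]
      rintro f ⟨hf, hs, ht⟩
      rw [sup_edge_deleteEdges (key f hf hs ht)]
      refine ⟨⟨sup_le hf.1 ((SimpleGraph.edge_le_iff _).2 (.inr hG)), isTree_sup_edge hf hs ht⟩,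
        ?_, hs, ht⟩
      simp [SimpleGraph.edge_adj, hG.ne]
    · simp only [Finset.mem_filter, Finset.mem_univ, true_and]
      rintro T ⟨⟨hTG, hT⟩, hab, hs, ht⟩
      exact ⟨deleteEdges_mem_twoForests hTG hT hab hs ht, hs, ht⟩
    · simp only [Finset.mem_filter, Finset.mem_univ, true_and]
      rintro f ⟨hf, hs, ht⟩
      exact sup_edge_deleteEdges (key f hf hs ht)
    · simp only [Finset.mem_filter, Finset.mem_univ, true_and]
      rintro T ⟨-, hab, -⟩
      exact deleteEdges_sup_edge hab
    · simp only [Finset.mem_filter, Finset.mem_univ, true_and]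
      rintro f ⟨hf, hs, ht⟩
      exact (graphWeight_sup_edge c μ hG.ne (key f hf hs ht)).symm
  -- If `ab` is not an edge of `G`, no tree below `G` contains it, so both sides vanish.
  · rw [zero_mul, Finset.filter_false_of_mem, Finset.sum_empty]
    exact fun T _ h => hG (h.1.1 h.2.1)

-- The cancellation behind harmonicity: grouped by spanning tree, each side weights a tree by a
-- count that is symmetric in `s` and `t`.
open Classical in
theorem sum_pairWeight_mul_sum_twoForests_comm [Fintype V] (G : SimpleGraph V) (c : Sym2 V → ℝ)
    (μ : ℝ) {s t q : V} (hqs : q ≠ s) (hqt : q ≠ t) :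
    ∑ k, pairWeight G (edgeWeight c μ) q k * ∑ f : SimpleGraph V with
        f ∈ twoForests G s t ∧ f.Reachable s q ∧ f.Reachable t k, graphWeight c μ f =
      ∑ k, pairWeight G (edgeWeight c μ) q k * ∑ f : SimpleGraph V with
        f ∈ twoForests G t s ∧ f.Reachable t q ∧ f.Reachable s k, graphWeight c μ f := by
  have key : ∀ s t : V, ∑ k, pairWeight G (edgeWeight c μ) q k * ∑ f : SimpleGraph V with
        f ∈ twoForests G s t ∧ f.Reachable s q ∧ f.Reachable t k, graphWeight c μ f =
      ∑ T : SimpleGraph V with T ≤ G ∧ T.IsTree, (Finset.univ.filter fun k =>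
        IsNextTo T q t k ∧ ¬ IsNextTo T q s k).card * graphWeight c μ T := by
    intro s t
    simp_rw [sum_twoForests_eq_sum_trees, Finset.sum_filter (s := Finset.univ (α := SimpleGraph V))]
    rw [Finset.sum_comm]
    refine Finset.sum_congr rfl fun T _ => ?_
    by_cases hT : T ≤ G ∧ T.IsTree
    · simp only [and_iff_right hT, if_pos hT, reachable_and_isNextTo_iff hT.2]
      rw [← Finset.sum_filter, Finset.sum_const, nsmul_eq_mul]
    · rw [if_neg hT]
      exact Finset.sum_eq_zero fun k _ => if_neg fun h => hT h.1
  rw [key, key]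
  refine Finset.sum_congr rfl fun T hT => ?_
  rw [card_isNextTo_comm (Finset.mem_filter.1 hT).2.2 hqs hqt]

/-! ### The watershed probabilities solve the Dirichlet problem -/

/-- A function is a Dirichlet solution if it is harmonic off the seeds and takes the values `1` at
`s₁` and `0` at `s₂`. -/
structure IsDirichletSolution [Fintype V] (G : SimpleGraph V) (w : Sym2 V → ℝ) (s₁ s₂ : V)
    (x : V → ℝ) : Prop where
  left : x s₁ = 1
  right : x s₂ = 0
  harmonic : ∀ q, q ≠ s₁ → q ≠ s₂ → ∑ k, pairWeight G w q k * (x q - x k) = 0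

open Classical in
theorem watershedProb_eq [Fintype V] (G : SimpleGraph V) (c : Sym2 V → ℝ) (μ : ℝ) (s₁ s₂ q : V) :
    watershedProb G c μ s₁ s₂ q =
      (∑ f : SimpleGraph V with f ∈ twoForests G s₁ s₂,
        if f.Reachable s₁ q then graphWeight c μ f else 0) /
      ∑ f : SimpleGraph V with f ∈ twoForests G s₁ s₂, graphWeight c μ f := by
  unfold watershedProb gibbs
  rw [← Finset.sum_div, ← Finset.sum_filter]
  congr 1
  · refine Finset.sum_congr ?_ fun _ _ => rfl
    ext f
    simp only [Set.mem_toFinset, Finset.mem_filter, Finset.mem_univ, true_and]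
    refine and_congr_right fun hf => ?_
    have h := not_reachable_left_iff hf q
    constructor
    · intro hq
      by_contra h'
      exact hq.2.2.2 (h.1 h').symm
    · exact fun hq => ⟨hf.1, hf.2.1, hf.2.2.1, fun h' => hf.2.2.2 (hq.trans h')⟩
  · refine Finset.sum_congr ?_ fun _ _ => rfl
    ext f
    simp

theorem isDirichletSolution_watershedProb [Fintype V] {G : SimpleGraph V} (hG : G.Connected)
    (c : Sym2 V → ℝ) (μ : ℝ) {s₁ s₂ : V} (hs : s₁ ≠ s₂) :
    IsDirichletSolution G (edgeWeight c μ) s₁ s₂ (watershedProb G c μ s₁ s₂) := by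
  classical
  refine ⟨?_, ?_, fun q hq₁ hq₂ => ?_⟩
  · rw [watershedProb_eq]
    simp only [SimpleGraph.Reachable.rfl, if_true]
    refine div_self (Finset.sum_pos (fun f _ => Real.exp_pos _) ?_).ne'
    obtain ⟨f, hf⟩ := nonempty_twoForests hG hs
    exact ⟨f, by simpa using hf⟩
  · rw [watershedProb_eq, Finset.sum_eq_zero, zero_div]
    intro f hf
    exact if_neg (Finset.mem_filter.1 hf).2.2.2.2
  · simp only [watershedProb_eq, ← sub_div, mul_div_assoc', ← Finset.sum_div,
      ← Finset.sum_sub_distrib]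
    rw [div_eq_zero_iff]
    left
    have h := sum_pairWeight_mul_sum_twoForests_comm G c μ hq₁ hq₂
    rw [← sub_eq_zero, ← Finset.sum_sub_distrib] at h
    -- The identity holds forest by forest: `1[s₁∼q] - 1[s₁∼k] = 1[s₁∼q, s₂∼k] - 1[s₂∼q, s₁∼k]`.
    refine Eq.trans (Finset.sum_congr rfl fun k _ => ?_) h
    rw [← mul_sub, twoForests_comm G s₂ s₁]
    congr 1
    simp_rw [← Finset.filter_filter (fun f => f ∈ twoForests G s₁ s₂)]
    rw [Finset.sum_filter (s := Finset.filter _ _), Finset.sum_filter (s := Finset.filter _ _),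
      ← Finset.sum_sub_distrib]
    refine Finset.sum_congr rfl fun f hf => ?_
    have hf := (Finset.mem_filter.1 hf).2
    have hq := not_reachable_left_iff hf q
    have hk := not_reachable_left_iff hf k
    simp only [← hq, ← hk]
    by_cases h₁ : f.Reachable s₁ q <;> by_cases h₂ : f.Reachable s₁ k <;> simp [h₁, h₂]

/-! ### Uniqueness for the Dirichlet problem -/

theorem pairWeight_nonneg {G : SimpleGraph V} {w : Sym2 V → ℝ} (hw : ∀ e, 0 < w e) (u v : V) :
    0 ≤ pairWeight G w u v := by
  unfold pairWeight
  split_ifs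
  exacts [(hw _).le, le_rfl]

theorem pairWeight_pos {G : SimpleGraph V} {w : Sym2 V → ℝ} (hw : ∀ e, 0 < w e) {u v : V}
    (h : G.Adj u v) : 0 < pairWeight G w u v := by
  rw [pairWeight, if_pos h]
  exact hw _

theorem pairWeight_self (G : SimpleGraph V) (w : Sym2 V → ℝ) (u : V) : pairWeight G w u u = 0 :=
  if_neg G.irrefl

/-- The maximum principle: a function that is harmonic off the seeds and vanishes at the seeds is
nowhere positive. -/
theorem nonpos_of_harmonic [Fintype V] {G : SimpleGraph V} (hG : G.Connected) {w : Sym2 V → ℝ}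
    (hw : ∀ e, 0 < w e) {s₁ s₂ : V} {x : V → ℝ} (h₁ : x s₁ = 0) (h₂ : x s₂ = 0)
    (hx : ∀ q, q ≠ s₁ → q ≠ s₂ → ∑ k, pairWeight G w q k * (x q - x k) = 0) (q : V) :
    x q ≤ 0 := by
  have : Nonempty V := ⟨q⟩
  obtain ⟨m, hm⟩ := Finite.exists_max x
  -- The maximum is carried along a walk to `s₁`: at an unseeded vertex harmonicity passes it to
  -- every neighbour, so it is attained at a seed, where `x` is zero.
  suffices key : ∀ v, G.Reachable v s₁ → x v = x m → x m = 0 from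
    (hm q).trans (key m (hG.preconnected m s₁) rfl).le
  rintro v ⟨p⟩
  induction p with
  | nil => exact fun h => h ▸ h₁
  | @cons v k s hvk p ih =>
    intro hv
    by_cases hv₁ : v = s
    · rw [← hv, hv₁, h₁]
    by_cases hv₂ : v = s₂
    · rw [← hv, hv₂, h₂]
    refine ih h₁ hx ?_
    have h := (Finset.sum_eq_zero_iff_of_nonneg fun k _ =>
      mul_nonneg (pairWeight_nonneg hw v k) (sub_nonneg.2 (hv ▸ hm k))).1 (hx v hv₁ hv₂) k
        (Finset.mem_univ k)
    rw [mul_eq_zero, or_iff_right (pairWeight_pos hw hvk).ne', sub_eq_zero] at h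
    rw [← h, hv]

theorem IsDirichletSolution.unique [Fintype V] {G : SimpleGraph V} (hG : G.Connected)
    {w : Sym2 V → ℝ} (hw : ∀ e, 0 < w e) {s₁ s₂ : V} {x y : V → ℝ}
    (hx : IsDirichletSolution G w s₁ s₂ x) (hy : IsDirichletSolution G w s₁ s₂ y) : x = y := by
  have key : ∀ {x y : V → ℝ}, IsDirichletSolution G w s₁ s₂ x → IsDirichletSolution G w s₁ s₂ y →
      ∀ q, x q ≤ y q := by
    intro x y hx hy q
    refine sub_nonpos.1 (nonpos_of_harmonic (s₁ := s₁) (s₂ := s₂) (x := fun v => x v - y v) hG hw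
      (by simp [hx.left, hy.left]) (by simp [hx.right, hy.right]) (fun v h₁ h₂ => ?_) q)
    rw [← sub_self (0 : ℝ)]
    nth_rw 1 [← hx.harmonic v h₁ h₂]
    rw [← hy.harmonic v h₁ h₂, ← Finset.sum_sub_distrib]
    exact Finset.sum_congr rfl fun k _ => by ring
  exact funext fun q => le_antisymm (key hx hy q) (key hy hx q)

theorem laplacian_mulVec [Fintype V] (G : SimpleGraph V) (w : Sym2 V → ℝ) (x : V → ℝ) (u : V) :
    ∑ v, laplacian G w u v * x v = ∑ k, pairWeight G w u k * (x u - x k) := by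
  classical
  have h : ∀ v, laplacian G w u v * x v =
      (if u = v then (∑ k, pairWeight G w u k) * x u else 0) - pairWeight G w u v * x v := by
    intro v
    by_cases huv : u = v
    · subst huv
      simp [laplacian, pairWeight_self]
    · simp [laplacian, huv]
  simp_rw [h, Finset.sum_sub_distrib, mul_sub]
  rw [Finset.sum_ite_eq, if_pos (Finset.mem_univ u), Finset.sum_mul, Finset.sum_sub_distrib]

theorem isRandomWalkerSolution_iff [Fintype V] {G : SimpleGraph V} {w : Sym2 V → ℝ} {s₁ s₂ : V}
    (hs : s₁ ≠ s₂) {x : V → ℝ} :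
    IsRandomWalkerSolution G w s₁ s₂ x ↔ IsDirichletSolution G w s₁ s₂ x := by
  classical
  have key : ∀ u : V, x s₁ = 1 → x s₂ = 0 →
      ∑ k, pairWeight G w u k * (x u - x k) =
        (∑ v : Unseeded s₁ s₂, laplacian G w u v * x v) + laplacian G w u s₁ := by
    intro u h₁ h₂
    rw [← laplacian_mulVec, ← Fintype.sum_subtype_add_sum_subtype (fun v => v ≠ s₁ ∧ v ≠ s₂)]
    congr 1
    -- Of the two seed columns, that of `s₂` drops out and that of `s₁` becomes `B`.
    rw [← Finset.sum_subtype {s₁, s₂} (fun v => by simp; tauto)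
      (fun v => laplacian G w u v * x v), Finset.sum_pair hs, h₁, h₂]
    ring
  constructor
  · rintro ⟨h₁, h₂, h⟩
    refine ⟨h₁, h₂, fun q hq₁ hq₂ => ?_⟩
    rw [key q h₁ h₂, ← eq_neg_iff_add_eq_zero]
    exact congrFun h ⟨q, hq₁, hq₂⟩
  · rintro ⟨h₁, h₂, h⟩
    refine ⟨h₁, h₂, funext fun u => ?_⟩
    have := h u u.2.1 u.2.2
    rw [key u h₁ h₂, ← eq_neg_iff_add_eq_zero] at this
    exact this

/-! ### The random walk stopped at the seeds -/

open Classical in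
/-- The position at time `n` of the trajectory stopped at the seeds. -/
def stoppedPos (s₁ s₂ : V) (ω : ℕ → V) : ℕ → V
  | 0 => ω 0
  | n + 1 => if stoppedPos s₁ s₂ ω n = s₁ ∨ stoppedPos s₁ s₂ ω n = s₂ then stoppedPos s₁ s₂ ω n
      else ω (n + 1)

open Classical in
/-- The averaging operator of the random walk stopped at the seeds. -/
def stoppedStep [Fintype V] (G : SimpleGraph V) (w : Sym2 V → ℝ) (s₁ s₂ : V) (g : V → ℝ) (v : V) :
    ℝ :=
  if v = s₁ ∨ v = s₂ then g v else ∑ k, (stepPMF G w v k).toReal * g k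

theorem stoppedPos_eq_or (s₁ s₂ : V) (ω : ℕ → V) (n : ℕ) :
    stoppedPos s₁ s₂ ω n = ω n ∨ stoppedPos s₁ s₂ ω n = s₁ ∨ stoppedPos s₁ s₂ ω n = s₂ := by
  cases n with
  | zero => exact .inl rfl
  | succ n =>
    rw [stoppedPos]
    split_ifs with h
    · exact .inr h
    · exact .inl rfl

theorem stoppedPos_congr (s₁ s₂ : V) {ω ω' : ℕ → V} {n : ℕ} (h : ∀ m ≤ n, ω m = ω' m) :
    stoppedPos s₁ s₂ ω n = stoppedPos s₁ s₂ ω' n := by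
  induction n with
  | zero => exact h 0 le_rfl
  | succ n ih =>
    rw [stoppedPos, stoppedPos, ih fun m hm => h m (hm.trans n.le_succ), h (n + 1) le_rfl]

/-- Only the first clause is used later; the other two make the induction close. -/
theorem stoppedPos_eq_left_iff {s₁ s₂ : V} (hs : s₁ ≠ s₂) (ω : ℕ → V) (n : ℕ) :
    (stoppedPos s₁ s₂ ω n = s₁ ↔ ∃ m ≤ n, ω m = s₁ ∧ ∀ j ≤ m, ω j ≠ s₂) ∧
      (stoppedPos s₁ s₂ ω n = s₂ → ∃ m ≤ n, ω m = s₂ ∧ ∀ j ≤ m, ω j ≠ s₁) ∧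
      (stoppedPos s₁ s₂ ω n ≠ s₁ → stoppedPos s₁ s₂ ω n ≠ s₂ →
        ∀ m ≤ n, ω m ≠ s₁ ∧ ω m ≠ s₂) := by
  induction n with
  | zero =>
    simp only [stoppedPos, nonpos_iff_eq_zero, exists_eq_left, forall_eq]
    refine ⟨⟨fun h => ⟨h, h ▸ hs⟩, And.left⟩, fun h => ⟨h, h ▸ hs.symm⟩, fun h h' => ⟨h, h'⟩⟩
  | succ n ih =>
    obtain ⟨ih₁, ih₂, ih₃⟩ := ih
    rw [stoppedPos]
    split_ifs with h
    · rcases h with h | h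
      · simp only [h, hs, true_iff, false_imp_iff, ne_eq, not_true, and_true]
        obtain ⟨m, hm, hm'⟩ := ih₁.1 h
        exact ⟨m, hm.trans n.le_succ, hm'⟩
      · obtain ⟨m, hm, hm', hm''⟩ := ih₂ h
        simp only [h, hs.symm, false_iff, ne_eq, not_true, false_imp_iff, imp_true_iff, and_true,
          true_imp_iff]
        refine ⟨?_, m, hm.trans n.le_succ, hm', hm''⟩
        rintro ⟨j, -, hj, hj'⟩
        rcases le_total j m with hjm | hjm
        · exact hm'' j hjm hj
        · exact hj' m hjm hm'
    · have hn := ih₃ (fun h' => h (.inl h')) (fun h' => h (.inr h'))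
      refine ⟨⟨fun h' => ⟨n + 1, le_rfl, h', fun j hj => ?_⟩, ?_⟩,
        fun h' => ⟨n + 1, le_rfl, h', fun j hj => ?_⟩, fun h₁ h₂ m hm => ?_⟩
      · rcases Nat.le_succ_iff.1 hj with hj | rfl
        · exact (hn j hj).2
        · exact h' ▸ hs
      · rintro ⟨m, hm, hm', -⟩
        rcases Nat.le_succ_iff.1 hm with hm | rfl
        · exact absurd hm' (hn m hm).1
        · exact hm'
      · rcases Nat.le_succ_iff.1 hj with hj | rfl
        · exact (hn j hj).1
        · exact h' ▸ hs.symm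
      · rcases Nat.le_succ_iff.1 hm with hm | rfl
        · exact hn m hm
        · exact ⟨h₁, h₂⟩

section Law

variable [Fintype V] [MeasurableSpace V] [MeasurableSingletonClass V]

instance (G : SimpleGraph V) (w : Sym2 V → ℝ) (q : V) : IsProbabilityMeasure (walkLaw G w q) := by
  unfold walkLaw
  infer_instance

/-- The Markov property at time `n`, for the expectation of a function of the path up to time `n`
and the next position. -/
theorem integral_walkLaw_succ (G : SimpleGraph V) (w : Sym2 V → ℝ) (q : V) (n : ℕ)
    (F : (Finset.Iic n → V) × V → ℝ) :
    ∫ ω, F (Preorder.frestrictLe n ω, ω (n + 1)) ∂walkLaw G w q =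
      ∫ ω, ∑ k, (stepPMF G w (ω n) k).toReal * F (Preorder.frestrictLe n ω, k)
        ∂walkLaw G w q := by
  have hF : Measurable F := measurable_of_countable F
  have h := Kernel.partialTraj_compProd_eq_map_traj (X := fun _ => V) (κ := stepKernel G w)
    (Nat.zero_le n) (x₀ := fun _ => q)
  have h' := Kernel.traj_map_frestrictLe_apply (X := fun _ => V) (κ := stepKernel G w) 0 n
    (fun _ => q)
  calc ∫ ω, F (Preorder.frestrictLe n ω, ω (n + 1)) ∂walkLaw G w q
      = ∫ z, F z ∂((walkLaw G w q).map fun ω => (Preorder.frestrictLe n ω, ω (n + 1))) := by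
        rw [integral_map (by fun_prop) hF.aestronglyMeasurable]
    _ = ∫ p, ∫ k, F (p, k) ∂stepKernel G w n p
          ∂((walkLaw G w q).map (Preorder.frestrictLe n)) := by
        unfold walkLaw
        rw [h', ← h, Measure.integral_compProd (Integrable.of_finite)]
    _ = ∫ ω, ∫ k, F (Preorder.frestrictLe n ω, k) ∂stepKernel G w n (Preorder.frestrictLe n ω)
          ∂walkLaw G w q := by
        rw [integral_map (by fun_prop) (measurable_of_countable _).aestronglyMeasurable]
    _ = _ := by
        refine integral_congr_ae (.of_forall fun ω => ?_)
        exact PMF.integral_eq_sum _ _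

theorem integral_stoppedPos_succ (G : SimpleGraph V) (w : Sym2 V → ℝ) (s₁ s₂ q : V) (n : ℕ)
    (g : V → ℝ) :
    ∫ ω, g (stoppedPos s₁ s₂ ω (n + 1)) ∂walkLaw G w q =
      ∫ ω, stoppedStep G w s₁ s₂ g (stoppedPos s₁ s₂ ω n) ∂walkLaw G w q := by
  classical
  -- The stopped position must be a function of the path up to time `n`; the filler `q` after time
  -- `n` is arbitrary by `stoppedPos_congr`.
  let ext : (Finset.Iic n → V) → ℕ → V := fun p m =>
    if h : m ≤ n then p ⟨m, Finset.mem_Iic.2 h⟩ else q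
  have hext : ∀ ω : ℕ → V, stoppedPos s₁ s₂ (ext (Preorder.frestrictLe n ω)) n =
      stoppedPos s₁ s₂ ω n := fun ω =>
    stoppedPos_congr s₁ s₂ fun m hm => by simp [ext, hm]
  have h := integral_walkLaw_succ G w q n fun z =>
    g (if stoppedPos s₁ s₂ (ext z.1) n = s₁ ∨ stoppedPos s₁ s₂ (ext z.1) n = s₂
      then stoppedPos s₁ s₂ (ext z.1) n else z.2)
  simp only [hext] at h
  refine h.trans (integral_congr_ae (.of_forall fun ω => ?_))
  simp only [stoppedStep]
  split_ifs with hω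
  -- At a seed the integrand does not depend on the next position, and the step probabilities sum to
  -- `1`.
  · rw [← Finset.sum_mul, ← ENNReal.toReal_sum fun k _ => PMF.apply_ne_top _ _,
      ← tsum_fintype (L := .unconditional V),
      PMF.tsum_coe, ENNReal.toReal_one, one_mul]
  · rw [(stoppedPos_eq_or s₁ s₂ ω n).resolve_right hω]

/-- The induction varies `g`, since each time step removed replaces `g` by its average. -/
theorem integral_stoppedPos (G : SimpleGraph V) (w : Sym2 V → ℝ) (s₁ s₂ q : V) (n : ℕ)
    (g : V → ℝ) :
    ∫ ω, g (stoppedPos s₁ s₂ ω n) ∂walkLaw G w q = (stoppedStep G w s₁ s₂)^[n] g q := by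
  induction n generalizing g with
  | zero =>
    have h := Kernel.traj_map_frestrictLe_apply (X := fun _ => V) (κ := stepKernel G w) 0 0
      (fun _ => q)
    rw [Kernel.partialTraj_self, Kernel.id_apply] at h
    have hg : Measurable fun p : Finset.Iic 0 → V => g (p ⟨0, Finset.mem_Iic.2 le_rfl⟩) :=
      measurable_of_countable _
    calc ∫ ω, g (ω 0) ∂walkLaw G w q
        = ∫ p, g (p ⟨0, Finset.mem_Iic.2 le_rfl⟩)
            ∂((walkLaw G w q).map (Preorder.frestrictLe 0)) := by
          rw [integral_map (by fun_prop) hg.aestronglyMeasurable]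
          rfl
      _ = g q := by
          unfold walkLaw
          rw [h, integral_dirac' _ _ hg.stronglyMeasurable]
  | succ n ih => rw [integral_stoppedPos_succ, ih, Function.iterate_succ_apply]

open Classical in
/-- The probability of having reached `s₁` before `s₂` by time `n` is an iterate of the averaging
operator. -/
theorem walkLaw_real_hit_le (G : SimpleGraph V) (w : Sym2 V → ℝ) {s₁ s₂ : V} (hs : s₁ ≠ s₂)
    (q : V) (n : ℕ) :
    (walkLaw G w q).real {ω | ∃ m ≤ n, ω m = s₁ ∧ ∀ j ≤ m, ω j ≠ s₂} =
      (stoppedStep G w s₁ s₂)^[n] (fun v => if v = s₁ then 1 else 0) q := by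
  have hm : MeasurableSet {ω : ℕ → V | ∃ m ≤ n, ω m = s₁ ∧ ∀ j ≤ m, ω j ≠ s₂} := by
    measurability
  rw [← integral_stoppedPos, ← integral_indicator_one hm]
  refine integral_congr_ae (.of_forall fun ω => ?_)
  simp only [Set.indicator_apply, Set.mem_ofPred_eq, (stoppedPos_eq_left_iff hs ω n).1,
    Pi.one_apply]

-- Continuity from below: the events of success by time `n` increase to the hitting event.
open Classical in
theorem tendsto_iterate_stoppedStep (G : SimpleGraph V) (w : Sym2 V → ℝ) {s₁ s₂ : V}
    (hs : s₁ ≠ s₂) (q : V) :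
    Filter.Tendsto
      (fun n => (stoppedStep G w s₁ s₂)^[n] (fun v => if v = s₁ then 1 else 0) q)
      Filter.atTop (nhds (hitProb G w s₁ s₂ q)) := by
  simp_rw [← walkLaw_real_hit_le G w hs]
  have hmono : Monotone fun n => {ω : ℕ → V | ∃ m ≤ n, ω m = s₁ ∧ ∀ j ≤ m, ω j ≠ s₂} :=
    fun a b hab ω ⟨m, hm, h⟩ => ⟨m, hm.trans hab, h⟩
  have h := tendsto_measure_iUnion_atTop (μ := walkLaw G w q) hmono
  have hU : ⋃ n, {ω : ℕ → V | ∃ m ≤ n, ω m = s₁ ∧ ∀ j ≤ m, ω j ≠ s₂} =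
      {ω | ∃ n, ω n = s₁ ∧ ∀ m ≤ n, ω m ≠ s₂} := by
    ext ω
    simp only [Set.mem_iUnion, Set.mem_ofPred_eq]
    exact ⟨fun ⟨_, m, _, h⟩ => ⟨m, h⟩, fun ⟨m, h⟩ => ⟨m, m, le_rfl, h⟩⟩
  rw [hU] at h
  exact (ENNReal.tendsto_toReal (measure_ne_top _ _)).comp h

/-- The averaging operator is a finite sum, so it passes to the limit of the iterates, and shifting
the sequence by one keeps the limit. -/
theorem stoppedStep_hitProb (G : SimpleGraph V) (w : Sym2 V → ℝ) {s₁ s₂ : V} (hs : s₁ ≠ s₂) :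
    stoppedStep G w s₁ s₂ (hitProb G w s₁ s₂) = hitProb G w s₁ s₂ := by
  classical
  funext q
  have h := fun q => tendsto_iterate_stoppedStep G w hs q
  refine tendsto_nhds_unique ?_ ((Filter.tendsto_add_atTop_iff_nat 1).2 (h q))
  simp only [Function.iterate_succ_apply']
  unfold stoppedStep
  split_ifs
  · exact h q
  · exact tendsto_finsetSum _ fun k _ => (h k).const_mul _

theorem hitProb_left (G : SimpleGraph V) (w : Sym2 V → ℝ) {s₁ s₂ : V} (hs : s₁ ≠ s₂) :
    hitProb G w s₁ s₂ s₁ = 1 := by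
  classical
  refine tendsto_nhds_unique (tendsto_iterate_stoppedStep G w hs s₁)
    (tendsto_const_nhds.congr fun n => ?_)
  induction n with
  | zero => simp
  | succ n ih => rw [Function.iterate_succ_apply', stoppedStep, if_pos (.inl rfl), ← ih]

theorem hitProb_right (G : SimpleGraph V) (w : Sym2 V → ℝ) {s₁ s₂ : V} (hs : s₁ ≠ s₂) :
    hitProb G w s₁ s₂ s₂ = 0 := by
  classical
  refine tendsto_nhds_unique (tendsto_iterate_stoppedStep G w hs s₂)
    (tendsto_const_nhds.congr fun n => ?_)
  induction n with
  | zero => simp [hs.symm]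
  | succ n ih => rw [Function.iterate_succ_apply', stoppedStep, if_pos (.inr rfl), ← ih]

end Law

theorem sum_pairWeight_pos [Fintype V] {G : SimpleGraph V} (hG : G.Connected) {w : Sym2 V → ℝ}
    (hw : ∀ e, 0 < w e) {u v : V} (huv : u ≠ v) : 0 < ∑ k, pairWeight G w u k := by
  have : Nontrivial V := ⟨u, v, huv⟩
  obtain ⟨k, hk⟩ := hG.preconnected.exists_adj_of_nontrivial u
  exact Finset.sum_pos' (fun k _ => pairWeight_nonneg hw u k)
    ⟨k, Finset.mem_univ k, pairWeight_pos hw hk⟩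

/-- A second vertex `v` and connectedness give `u` a neighbour, which rules out the absorbing case
of `stepPMF`. -/
theorem stepPMF_toReal [Fintype V] {G : SimpleGraph V} (hG : G.Connected) {w : Sym2 V → ℝ}
    (hw : ∀ e, 0 < w e) {u v : V} (huv : u ≠ v) (k : V) :
    (stepPMF G w u k).toReal = pairWeight G w u k / ∑ j, pairWeight G w u j := by
  have hsum : ∑' j, ENNReal.ofReal (pairWeight G w u j) =
      ENNReal.ofReal (∑ j, pairWeight G w u j) := by
    rw [tsum_fintype, ENNReal.ofReal_sum_of_nonneg fun j _ => pairWeight_nonneg hw u j]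
  have hpos := sum_pairWeight_pos hG hw huv
  rw [stepPMF, dif_neg (by rw [hsum]; simpa using hpos), PMF.normalize_apply, hsum,
    ENNReal.toReal_mul, ENNReal.toReal_inv, ENNReal.toReal_ofReal hpos.le,
    ENNReal.toReal_ofReal (pairWeight_nonneg hw u k), div_eq_mul_inv]

theorem isDirichletSolution_hitProb [Fintype V] [MeasurableSpace V] [MeasurableSingletonClass V]
    {G : SimpleGraph V} (hG : G.Connected) {w : Sym2 V → ℝ} (hw : ∀ e, 0 < w e) {s₁ s₂ : V}
    (hs : s₁ ≠ s₂) : IsDirichletSolution G w s₁ s₂ (hitProb G w s₁ s₂) := by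
  refine ⟨hitProb_left G w hs, hitProb_right G w hs, fun q h₁ h₂ => ?_⟩
  have h := congrFun (stoppedStep_hitProb G w hs) q
  rw [stoppedStep, if_neg (not_or.2 ⟨h₁, h₂⟩)] at h
  simp_rw [stepPMF_toReal hG hw h₁, div_mul_eq_mul_div] at h
  rw [← Finset.sum_div, div_eq_iff (sum_pairWeight_pos hG hw h₁).ne', mul_comm,
    Finset.sum_mul] at h
  simp_rw [mul_sub]
  rw [Finset.sum_sub_distrib, h, sub_self]

end

end ProbWatershed

/-- On a finite connected graph with edge weights `exp(-μ c(e))` and distinct seeds `s₁`, `s₂`, the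
Random Walker probability of every node equals its Probabilistic Watershed probability, both for
the hitting probability of the walk and for the (unique) solution of the Random Walker's linear
system. -/
theorem theorem4p1 {V : Type*} [Fintype V] [MeasurableSpace V] [MeasurableSingletonClass V]
    (G : SimpleGraph V) (hG : G.Connected) (c : Sym2 V → ℝ) (μ : ℝ) (hμ : 0 ≤ μ)
    (s₁ s₂ : V) (hs : s₁ ≠ s₂) :
    (∀ q : V, ProbWatershed.hitProb G (ProbWatershed.edgeWeight c μ) s₁ s₂ q =
      ProbWatershed.watershedProb G c μ s₁ s₂ q) ∧
    (∀ x : V → ℝ,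
      ProbWatershed.IsRandomWalkerSolution G (ProbWatershed.edgeWeight c μ) s₁ s₂ x ↔
        ∀ q : V, x q = ProbWatershed.watershedProb G c μ s₁ s₂ q) := by
  have hw : ∀ e, 0 < ProbWatershed.edgeWeight c μ e := fun e => Real.exp_pos _
  have hP := ProbWatershed.isDirichletSolution_watershedProb hG c μ hs
  refine ⟨fun q => congrFun
    ((ProbWatershed.isDirichletSolution_hitProb hG hw hs).unique hG hw hP) q, fun x => ?_⟩
  rw [ProbWatershed.isRandomWalkerSolution_iff hs]
  exact ⟨fun hx q => congrFun (hx.unique hG hw hP) q, fun hx => funext hx ▸ hP⟩
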